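/- Let $\mathcal S$ be the category of the finite ordinals $\underline n=\{1,\dots,n\}$ ($n\in\mathbb N$) and all maps between them. For $\varphi\colon\underline m\to\underline n$ in $\mathcal S$ and $i\in\underline n$, let $\varepsilon_{\varphi,i}\colon\varphi^{-1}(i)\to\underline m$ be the unique monotone injection of $\mathcal S$ with image $\{j:\varphi(j)=i\}$; for $\psi\colon\underline\ell\to\underline m$, let $\psi^\varphi_i\colon(\varphi\psi)^{-1}(i)\to\varphi^{-1}(i)$ be the unique map with $\varepsilon_{\varphi,i}\,\psi^\varphi_i=\psi\,\varepsilon_{\varphi\psi,i}$. A small category is endowed with local terminal objects if each connected component has a chosen terminal object; write $\tau_X\colon X\to uX$ for the unique map from $X$ to the chosen terminal object of its component. Let $\mathbf{Cat}/\!/\mathcal S$ be the lax slice category: objects are small categories $\mathcal C$ with a functor $|{-}|\colon\mathcal C\to\mathcal S$; morphisms are pairs of a functor $F\colon\mathcal C\to\mathcal C'$ and a natural transformation $\nu_X\colon|X|\to|FX|$. Let $\mathbf{Cat}_{\ell t}/\!/\mathcal S$ be the corresponding category in which $\mathcal C$ is endowed with local terminal objects, $|uX|=\underline 1$ for all $X$,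 and $F$ preserves the chosen local terminals; let $\mathbf{Cat}_{\ell t}/\mathcal S$ be its subcategory with the same objects and with those morphisms for which $\nu$ is an identity. The functor forgetting local terminals, $\mathbf{Cat}_{\ell t}/\!/\mathcal S\to\mathbf{Cat}/\!/\mathcal S$, has a right adjoint (whose composite with it underlies the modified décalage comonad), sending $(\mathcal C,|{-}|)$ to $D_m(\mathcal C)=\sum_{X\in\mathcal C,\,i\in|X|}\mathcal C/X$ with chosen local terminals $(X,i,1_X)$ and cardinalities $(X,i,f)\mapsto|f|^{-1}(i)$ and $\bigl(g\colon(X,i,fg)\to(X,i,f)\bigr)\mapsto|g|^{|f|}_i$; a morphism $(F,\nu)$ is sent to the functor $(X,i,f)\mapsto(FX,\nu_X(i),Ff)$ with the restrictions of $\nu$ to fibres. The counit is the domain projection $(X,i,f\colon Y\to X)\mapsto Y$, with natural transformation $\varepsilon_{|f|,i}\colon|f|^{-1}(i)\to|Y|$; the unit sends $X$ to $(uX,1,\tau_X)$. The monad on $\mathbf{Cat}_{\ell t}/\!/\mathcal S$ induced by this adjunction restricts to $\mathbf{Cat}_{\ell t}/\mathcal S$; the restriction is the modified décalage monad $\mathsf{\tilde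 D}_m$. An operadic category (Batanin–Markl) is an object $(\mathcal C,|{-}|)$ of $\mathbf{Cat}_{\ell t}/\mathcal S$ with, for all $X\in\mathcal C$ and $i\in|X|$, a functor $\mathcal C/X\to\mathcal C$, written $f\mapsto f^{-1}(i)$ on objects and $(g\colon fg\to f)\mapsto\bigl(g^f_i\colon(fg)^{-1}(i)\to f^{-1}(i)\bigr)$ on morphisms, such that: each $(1_X)^{-1}(i)$ is chosen terminal; $|f^{-1}(i)|=|f|^{-1}(i)$ and $|g^f_i|=|g|^{|f|}_i$; $\tau_X^{-1}(1)=X$ and $f^{\tau_X}_1=f$ for all $X$ and all $f\colon Y\to X$; and for $g\colon fg\to f$ and $h\colon fgh\to fg$ in $\mathcal C/X$, $i\in|X|$, $j\in|f|^{-1}(i)$, with $\varepsilon=\varepsilon_{|f|,i}$, one has $(g^f_i)^{-1}(j)=g^{-1}(\varepsilon j)$ and $(h^{fg}_i)^{g^f_i}_j=h^g_{\varepsilon j}$. An operadic functor is a functor $F$ that preserves chosen local terminals, commutes strictly with the cardinality functors, and satisfies $F(f^{-1}(i))=(Ff)^{-1}(i)$ and $F(g^f_i)=(Fg)^{Ff}_i$.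 Let $\mathbf{OpCat}$ be the category of operadic categories and operadic functors. Theorem. The category of algebras for the modified décalage monad $\mathsf{\tilde D}_m$ on $\mathbf{Cat}_{\ell t}/\mathcal S$ is isomorphic to the category $\mathbf{OpCat}$. -/

import Mathlib

open CategoryTheory

universe u

namespace Decalage

/-! ### The category of finite ordinals and all maps, with its fibres -/

/-- Objects of `𝒮`: the finite ordinals, one for each natural number. The elements of the
ordinal `n` are represented by `Fin n`. -/
@[ext]
structure FinOrd : Type where
  /-- the number of elements -/
  n : ℕ

/-- All functions are morphisms of `𝒮`. -/
instance : Category.{0} FinOrd where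
  Hom a b := Fin a.n → Fin b.n
  id _ := id
  comp f g := g ∘ f

/-- A morphism of `𝒮`, as a function. -/
def FinOrd.toFun {a b : FinOrd} (f : a ⟶ b) : Fin a.n → Fin b.n := f

/-- A function, as a morphism of `𝒮`. -/
def FinOrd.ofFun {a b : FinOrd} (f : Fin a.n → Fin b.n) : a ⟶ b := f

section Fibres

variable {l m n n' : ℕ}

/-- The subset `{j | φ j = i}` of the domain of `φ`. -/
def fibreSet (φ : Fin m → Fin n) (i : Fin n) : Finset (Fin m) :=
  Finset.univ.filter fun j => φ j = i

/-- The fibre `φ⁻¹(i)`, a finite ordinal. -/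
def fibre (φ : Fin m → Fin n) (i : Fin n) : FinOrd := ⟨(fibreSet φ i).card⟩

/-- The monotone injection `ε_{φ,i} : φ⁻¹(i) → m` with image `{j | φ j = i}`. -/
def fibreIncl (φ : Fin m → Fin n) (i : Fin n) : Fin (fibre φ i).n ↪o Fin m :=
  (fibreSet φ i).orderEmbOfFin rfl

/-- The element of `φ⁻¹(i)` sent to `j` by `ε_{φ,i}`, when `φ j = i`. -/
def fibreIndex (φ : Fin m → Fin n) (i : Fin n) (j : Fin m) (h : φ j = i) :
    Fin (fibre φ i).n :=
  ((fibreSet φ i).orderIsoOfFin rfl).symm ⟨j, by simp [fibreSet, h]⟩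

theorem fibreIncl_index (φ : Fin m → Fin n) (i : Fin n) (j : Fin m) (h : φ j = i) :
    fibreIncl φ i (fibreIndex φ i j h) = j := by
  have := ((fibreSet φ i).orderIsoOfFin rfl).apply_symm_apply ⟨j, by simp [fibreSet, h]⟩
  exact congrArg Subtype.val this

theorem apply_fibreIncl (φ : Fin m → Fin n) (i : Fin n) (k : Fin (fibre φ i).n) :
    φ (fibreIncl φ i k) = i := by
  have := (fibreSet φ i).orderEmbOfFin_mem rfl k
  exact (Finset.mem_filter.mp this).2

/-- Given `ψ` that maps the fibre of `φ'` at `i'` into the fibre of `φ` at `i`, the unique map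
`φ'⁻¹(i') → φ⁻¹(i)` commuting with `ψ` and the monotone injections. For `φ' = φ ∘ ψ` and
`i' = i` this is the fibre map `ψ^φ_i` of `ψ` with respect to `φ` at `i`. -/
def fibreMap (ψ : Fin l → Fin m) (φ' : Fin l → Fin n') (i' : Fin n') (φ : Fin m → Fin n)
    (i : Fin n) (h : ∀ j, φ' j = i' → φ (ψ j) = i) : fibre φ' i' ⟶ fibre φ i :=
  FinOrd.ofFun fun k => fibreIndex φ i (ψ (fibreIncl φ' i' k)) (h _ (apply_fibreIncl φ' i' k))

theorem fibreIncl_fibreMap (ψ : Fin l → Fin m) (φ' : Fin l → Fin n') (i' : Fin n')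
    (φ : Fin m → Fin n) (i : Fin n) (h : ∀ j, φ' j = i' → φ (ψ j) = i) (k) :
    fibreIncl φ i (FinOrd.toFun (fibreMap ψ φ' i' φ i h) k) = ψ (fibreIncl φ' i' k) :=
  fibreIncl_index φ i (ψ (fibreIncl φ' i' k)) (h _ (apply_fibreIncl φ' i' k))

theorem toFun_comp {a b c : FinOrd} (f : a ⟶ b) (g : b ⟶ c) (k : Fin a.n) :
    FinOrd.toFun (f ≫ g) k = FinOrd.toFun g (FinOrd.toFun f k) := rfl

theorem toFun_id {a : FinOrd} (k : Fin a.n) : FinOrd.toFun (𝟙 a) k = k := rfl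

theorem fibre_hom_ext {φ : Fin m → Fin n} {i : Fin n} {a : FinOrd} {f g : a ⟶ fibre φ i}
    (h : ∀ k, fibreIncl φ i (FinOrd.toFun f k) = fibreIncl φ i (FinOrd.toFun g k)) : f = g :=
  funext fun k => (fibreIncl φ i).injective (h k)

/-- A strictly monotone surjection between finite ordinals is an identity. -/
theorem eq_of_strictMono {f : Fin m → Fin n} (hf : StrictMono f) (hs : Function.Surjective f) :
    m = n ∧ ∀ k, (f k).val = k.val := by
  have hmn : m = n := by
    have := Fintype.card_of_bijective ⟨hf.injective, hs⟩
    simpa using this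
  subst hmn
  refine ⟨rfl, fun k => ?_⟩
  have : hf.orderIsoOfSurjective f hs = OrderIso.refl _ := Subsingleton.elim _ _
  have h2 := congrArg (fun e : Fin m ≃o Fin m => e k) this
  exact congrArg Fin.val h2

end Fibres

/-! ### Categories with local terminal objects -/

/-- A choice of a terminal object in each connected component of a category: `u X` is the chosen
terminal object of the component of `X`, and `τ X` is the unique map `X ⟶ u X`. A function of `X`
depends only on the component of `X` when it is invariant along morphisms. -/
structure LocalTerminals (C : Type u) [Category.{u} C] where
  /-- the chosen terminal object of the connected component -/
  u : C → C
  /-- the map to the chosen terminal object -/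
  τ : ∀ X, X ⟶ u X
  u_eq : ∀ {X Y : C}, (X ⟶ Y) → u X = u Y
  τ_uniq : ∀ {X : C} (f : X ⟶ u X), f = τ X

/-- `X` is one of the chosen terminal objects. -/
def LocalTerminals.IsChosen {C : Type u} [Category.{u} C] (t : LocalTerminals C) (X : C) : Prop :=
  t.u X = X

theorem LocalTerminals.isChosen_u {C : Type u} [Category.{u} C] (t : LocalTerminals C) (X : C) :
    t.IsChosen (t.u X) := (t.u_eq (t.τ X)).symm

theorem LocalTerminals.hom_uniq {C : Type u} [Category.{u} C] (t : LocalTerminals C) {X Y : C}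
    (hY : t.IsChosen Y) (f g : X ⟶ Y) : f = g := by
  have h : t.u X = Y := (t.u_eq f).trans hY
  subst h
  rw [t.τ_uniq f, t.τ_uniq g]

/-! ### The lax slice of categories over `𝒮` -/

/-- A small category with a functor to `𝒮`, its cardinality functor. -/
structure CatOver : Type (u + 1) where
  /-- the underlying category -/
  carrier : Type u
  [cat : SmallCategory.{u} carrier]
  /-- the cardinality functor -/
  card : carrier ⥤ FinOrd

attribute [instance] CatOver.cat

/-- The finite set `|X|`. -/
abbrev CatOver.El (A : CatOver.{u}) (X : A.carrier) : Type := Fin (A.card.obj X).n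

/-- The function `|f| : |X| → |Y|`. -/
def CatOver.act (A : CatOver.{u}) {X Y : A.carrier} (f : X ⟶ Y) : A.El X → A.El Y :=
  FinOrd.toFun (A.card.map f)

theorem CatOver.act_id (A : CatOver.{u}) (X : A.carrier) (i : A.El X) :
    A.act (𝟙 X) i = i := by
  unfold CatOver.act; rw [A.card.map_id]; rfl

theorem CatOver.act_comp (A : CatOver.{u}) {X Y Z : A.carrier} (f : X ⟶ Y) (g : Y ⟶ Z)
    (i : A.El X) : A.act (f ≫ g) i = A.act g (A.act f i) := by
  unfold CatOver.act; rw [A.card.map_comp]; rfl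

/-- A morphism of the lax slice: a functor `F` and a natural transformation `|-| ⟶ |F -|`. -/
@[ext]
structure LaxHom (A B : CatOver.{u}) where
  /-- the functor -/
  functor : A.carrier ⥤ B.carrier
  /-- the natural transformation filling the triangle over `𝒮` -/
  cell : A.card ⟶ functor ⋙ B.card

/-- The component `|X| → |F X|` of the natural transformation. -/
def LaxHom.relabel {A B : CatOver.{u}} (F : LaxHom A B) (X : A.carrier) :
    A.El X → B.El (F.functor.obj X) :=
  FinOrd.toFun (F.cell.app X)

theorem LaxHom.relabel_act {A B : CatOver.{u}} (F : LaxHom A B) {X Y : A.carrier} (f : X ⟶ Y)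
    (i : A.El X) :
    F.relabel Y (A.act f i) = B.act (F.functor.map f) (F.relabel X i) :=
  congrFun (F.cell.naturality f) i

theorem LaxHom.ext_val {A B : CatOver.{u}} {F G : LaxHom A B}
    (ho : ∀ X, F.functor.obj X = G.functor.obj X)
    (hm : ∀ {X Y : A.carrier} (f : X ⟶ Y), F.functor.map f ≍ G.functor.map f)
    (hc : ∀ X i, (F.relabel X i).val = (G.relabel X i).val) : F = G := by
  obtain ⟨F, ν⟩ := F
  obtain ⟨G, ν'⟩ := G
  obtain rfl : F = G := Functor.hext ho fun _ _ f => hm f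
  congr 1
  ext X
  funext i
  exact Fin.ext (hc X i)

/-- The lax slice category `Cat // 𝒮`. -/
instance : Category.{u} CatOver.{u} where
  Hom := LaxHom
  id A := ⟨𝟭 _, { app := fun _ => 𝟙 _ }⟩
  comp {A B C} F G := ⟨F.functor ⋙ G.functor,
    { app := fun X => F.cell.app X ≫ G.cell.app (F.functor.obj X)
      naturality := fun X Y f => by
        have h1 := F.cell.naturality f
        have h2 := G.cell.naturality (F.functor.map f)
        dsimp at h1 h2 ⊢
        rw [reassoc_of% h1, h2, Category.assoc] }⟩
  id_comp _ := rfl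
  comp_id _ := rfl
  assoc _ _ _ := rfl

/-! ### The lax slice of categories with local terminal objects over `𝒮` -/

/-- A small category with local terminal objects and a cardinality functor to `𝒮` that preserves
them: the unique terminal object of `𝒮`, which is the ordinal `1`, is its chosen one. -/
structure LtCatOver : Type (u + 1) extends CatOver.{u} where
  /-- the local terminal objects -/
  lt : LocalTerminals carrier
  card_u : ∀ X, card.obj (lt.u X) = ⟨1⟩

/-- The unique element of `|u X|`. -/
def LtCatOver.pt (A : LtCatOver.{u}) (X : A.carrier) : A.El (A.lt.u X) :=
  ⟨0, by rw [A.card_u X]; exact Nat.one_pos⟩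

theorem LtCatOver.el_u (A : LtCatOver.{u}) (X : A.carrier) (i j : A.El (A.lt.u X)) : i = j := by
  have h : (A.card.obj (A.lt.u X)).n = 1 := congrArg FinOrd.n (A.card_u X)
  apply Fin.ext
  have hi := i.isLt
  have hj := j.isLt
  omega

/-- A morphism of `Cat_ℓt // 𝒮`: a morphism of the lax slice whose functor maps chosen terminal
objects to chosen terminal objects. -/
structure LtHom (A B : LtCatOver.{u}) where
  /-- the morphism of the lax slice -/
  hom : A.toCatOver ⟶ B.toCatOver
  isChosen : ∀ X, A.lt.IsChosen X → B.lt.IsChosen (hom.functor.obj X)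

/-- The lax slice category `Cat_ℓt // 𝒮`. -/
instance : Category.{u} LtCatOver.{u} where
  Hom := LtHom
  id A := ⟨𝟙 A.toCatOver, fun _ h => h⟩
  comp F G := ⟨F.hom ≫ G.hom, fun X h => G.isChosen _ (F.isChosen X h)⟩
  id_comp _ := rfl
  comp_id _ := rfl
  assoc _ _ _ := rfl

theorem LtHom.ext' {A B : LtCatOver.{u}} {F G : A ⟶ B} (h : F.hom = G.hom) : F = G := by
  obtain ⟨F, hF⟩ := (F : LtHom A B)
  obtain ⟨G, hG⟩ := (G : LtHom A B)
  obtain rfl : F = G := h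
  rfl

/-- The functor that forgets local terminal objects. -/
def forgetLt : LtCatOver.{u} ⥤ CatOver.{u} where
  obj A := A.toCatOver
  map F := F.hom

/-! ### Modified décalage -/

/-- An object `(X, i, f : Y ⟶ X)` of `∑_{X, i ∈ |X|} C / X`. -/
structure DecObj (C : CatOver.{u}) : Type u where
  /-- the object `X` indexing the summand -/
  base : C.carrier
  /-- the element of `|X|` indexing the summand -/
  idx : C.El base
  /-- the domain `Y` of the object of the slice -/
  dom : C.carrier
  /-- the structure map of the object of the slice -/
  map : dom ⟶ base

/-- A morphism `g : (X, i, f g) ⟶ (X, i, f)` of `∑_{X, i ∈ |X|} C / X`, where `f g` denotes the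
composite of `g` followed by `f`: there are no morphisms between different summands, and
within the summand `C / X` a morphism is a commuting triangle. -/
@[ext]
structure DecHom {C : CatOver.{u}} (a b : DecObj C) : Type u where
  /-- the underlying morphism -/
  hom : a.dom ⟶ b.dom
  w : (⟨b.base, b.idx, a.dom, hom ≫ b.map⟩ : DecObj C) = a

theorem DecObj.ext_heq {C : CatOver.{u}} {a b : DecObj C} (h1 : a.base = b.base)
    (h2 : a.idx.val = b.idx.val) (h3 : a.dom = b.dom) (h4 : a.map ≍ b.map) : a = b := by
  obtain ⟨X, i, Y, f⟩ := a
  obtain ⟨X', i', Y', f'⟩ := b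
  obtain rfl : X = X' := h1
  obtain rfl : Y = Y' := h3
  obtain rfl : i = i' := Fin.ext h2
  obtain rfl : f = f' := eq_of_heq h4
  rfl

theorem DecHom.base_eq {C : CatOver.{u}} {a b : DecObj C} (g : DecHom a b) : a.base = b.base :=
  (congrArg DecObj.base g.w).symm

/-- The category `∑_{X, i ∈ |X|} C / X`. -/
instance (C : CatOver.{u}) : SmallCategory.{u} (DecObj C) where
  Hom := DecHom
  id a := ⟨𝟙 a.dom, by simp⟩
  comp {a b c} g h := ⟨g.hom ≫ h.hom, by
    obtain ⟨_, _, _, _⟩ := a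
    obtain ⟨_, _, _, _⟩ := b
    obtain ⟨_, _, _, _⟩ := c
    obtain ⟨g, w⟩ := g
    obtain ⟨h, w'⟩ := h
    dsimp only at g w h w'
    cases w'
    cases w
    simp⟩
  id_comp _ := DecHom.ext (Category.id_comp _)
  comp_id _ := DecHom.ext (Category.comp_id _)
  assoc _ _ _ := DecHom.ext (Category.assoc _ _ _)

theorem DecHom.heq {C : CatOver.{u}} {a b a' b' : DecObj C} (ha : a = a') (hb : b = b')
    {f : a ⟶ b} {g : a' ⟶ b'} (h : f.hom ≍ g.hom) : f ≍ g := by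
  subst ha hb
  exact heq_of_eq (DecHom.ext (eq_of_heq h))

theorem DecHom.act_eq {C : CatOver.{u}} {a b : DecObj C} (g : a ⟶ b) (j : C.El a.dom)
    (hj : C.act a.map j = a.idx) : C.act b.map (C.act g.hom j) = b.idx := by
  obtain ⟨_, _, _, _⟩ := a
  obtain ⟨_, _, _, _⟩ := b
  obtain ⟨g, w⟩ := g
  dsimp only at g w
  cases w
  exact (C.act_comp _ _ _).symm.trans hj

theorem DecHom.act_eq' {C : CatOver.{u}} {a b : DecObj C} (g : a ⟶ b) (j : C.El a.dom)
    (hj : C.act b.map (C.act g.hom j) = b.idx) : C.act a.map j = a.idx := by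
  obtain ⟨_, _, _, _⟩ := a
  obtain ⟨_, _, _, _⟩ := b
  obtain ⟨g, w⟩ := g
  dsimp only at g w
  cases w
  exact (C.act_comp _ _ _).trans hj

/-- The object `∑_{X, i ∈ |X|} C / X` of the lax slice: the cardinality of `(X, i, f)` is
`|f|⁻¹(i)`, and that of `g : (X, i, f g) ⟶ (X, i, f)` is the fibre map `|g|^|f|_i`. -/
abbrev dec (C : CatOver.{u}) : CatOver.{u} where
  carrier := DecObj C
  card :=
    { obj := fun a => fibre (C.act a.map) a.idx
      map := fun {a b} g => fibreMap (C.act g.hom) (C.act a.map) a.idx (C.act b.map) b.idx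
        (DecHom.act_eq g)
      map_id := fun a => fibre_hom_ext fun k => by
        rw [fibreIncl_fibreMap, toFun_id]
        exact C.act_id _ _
      map_comp := fun {a b c} g h => fibre_hom_ext fun k => by
        rw [toFun_comp, fibreIncl_fibreMap, fibreIncl_fibreMap, fibreIncl_fibreMap]
        exact C.act_comp _ _ _ }

theorem fibreIncl_dec_act {C : CatOver.{u}} {a b : DecObj C} (g : a ⟶ b)
    (k : (dec C).El a) :
    fibreIncl (C.act b.map) b.idx ((dec C).act (X := a) (Y := b) g k) =
      C.act g.hom (fibreIncl (C.act a.map) a.idx k) :=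
  fibreIncl_fibreMap _ _ _ _ _ (DecHom.act_eq g) k

/-- The chosen terminal objects of `∑_{X, i ∈ |X|} C / X` are the `(X, i, 1_X)`. -/
def decLt (C : CatOver.{u}) : LocalTerminals (DecObj C) where
  u a := ⟨a.base, a.idx, a.base, 𝟙 a.base⟩
  τ a := ⟨a.map, by simp⟩
  u_eq {a b} g := by
    obtain ⟨_, _, _, _⟩ := a
    obtain ⟨_, _, _, _⟩ := b
    obtain ⟨g, w⟩ := g
    dsimp only at g w
    cases w
    rfl
  τ_uniq {a} f := by
    apply DecHom.ext
    have h := f.w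
    obtain ⟨X, i, Y, g⟩ := a
    obtain ⟨f, hf⟩ := f
    simpa using h

theorem fibre_id {m : ℕ} {φ : Fin m → Fin m} (hφ : ∀ j, φ j = j) (i : Fin m) :
    fibre φ i = ⟨1⟩ := by
  have h : fibreSet φ i = {i} := by
    ext j
    simp [fibreSet, hφ]
  simp [fibre, h]

/-- The cofree object on an object of the lax slice. -/
abbrev cofree (C : CatOver.{u}) : LtCatOver.{u} where
  toCatOver := dec C
  lt := decLt C
  card_u a := fibre_id (C.act_id a.base) a.idx

theorem LaxHom.relabel_eq {C C' : CatOver.{u}} (F : LaxHom C C') (a : DecObj C)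
    (j : C.El a.dom) (hj : C.act a.map j = a.idx) :
    C'.act (F.functor.map a.map) (F.relabel a.dom j) = F.relabel a.base a.idx := by
  rw [← hj, F.relabel_act]

/-- The functor `(X, i, f) ↦ (F X, ν_X i, F f)` induced by a morphism `(F, ν)` of the lax
slice. -/
def decMapFunctor {C C' : CatOver.{u}} (F : C ⟶ C') : DecObj C ⥤ DecObj C' where
  obj := fun a => ⟨F.functor.obj a.base, F.relabel a.base a.idx, F.functor.obj a.dom,
    F.functor.map a.map⟩
  map := fun {a b} g => ⟨F.functor.map g.hom, by
    obtain ⟨_, _, _, _⟩ := a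
    obtain ⟨_, _, _, _⟩ := b
    obtain ⟨g, w⟩ := g
    dsimp only at g w
    cases w
    simp⟩
  map_id := fun a => DecHom.ext (F.functor.map_id _)
  map_comp := fun g h => DecHom.ext (F.functor.map_comp _ _)

/-- The action of modified décalage on a morphism `(F, ν)` of the lax slice. The functor sends
`(X, i, f)` to `(F X, ν_X i, F f)`; the natural transformation is the restriction of `ν`. -/
def decMap {C C' : CatOver.{u}} (F : C ⟶ C') : dec C ⟶ dec C' where
  functor := decMapFunctor F
  cell :=
    { app := fun (a : DecObj C) => fibreMap (F.relabel a.dom) (C.act a.map) a.idx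
        (C'.act (F.functor.map a.map)) (F.relabel a.base a.idx)
        (F.relabel_eq a)
      naturality := fun (a b : DecObj C) (g : a ⟶ b) => fibre_hom_ext fun k => by
        refine (fibreIncl_fibreMap _ _ _ _ _ (F.relabel_eq b) _).trans ?_
        refine Eq.trans ?_ (fibreIncl_fibreMap _ _ _ _ _
          (DecHom.act_eq ((decMapFunctor F).map g)) _).symm
        refine (congrArg (F.relabel b.dom) (fibreIncl_dec_act g k)).trans ?_
        refine (F.relabel_act g.hom _).trans ?_
        exact congrArg (C'.act (F.functor.map g.hom))
          (fibreIncl_fibreMap _ _ _ _ _ (F.relabel_eq a) k).symm }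

theorem fibreIncl_decMap {C C' : CatOver.{u}} (F : C ⟶ C') (a : DecObj C) (k : (dec C).El a) :
    fibreIncl (C'.act (F.functor.map a.map)) (F.relabel a.base a.idx)
      ((decMap F).relabel a k) = F.relabel a.dom (fibreIncl (C.act a.map) a.idx k) :=
  fibreIncl_fibreMap _ _ _ _ _ (F.relabel_eq a) k

theorem decMap_id (C : CatOver.{u}) : decMap (𝟙 C) = 𝟙 (dec C) := by
  refine LaxHom.ext_val (fun _ => rfl) (fun _ => HEq.rfl) fun a k => congrArg Fin.val ?_
  exact (fibreIncl (C.act a.map) a.idx).injective (fibreIncl_decMap (𝟙 C) a k)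

theorem decMap_comp {A B C : CatOver.{u}} (F : A ⟶ B) (G : B ⟶ C) :
    decMap (F ≫ G) = decMap F ≫ decMap G := by
  refine LaxHom.ext_val (fun _ => rfl) (fun _ => HEq.rfl) fun a k => congrArg Fin.val ?_
  apply (fibreIncl (C.act (G.functor.map (F.functor.map a.map)))
    (G.relabel _ (F.relabel a.base a.idx))).injective
  refine (fibreIncl_decMap (F ≫ G) a k).trans ?_
  refine Eq.trans ?_
    (fibreIncl_decMap G ((decMap F).functor.obj a) ((decMap F).relabel a k)).symm
  exact congrArg (G.relabel (F.functor.obj a.dom)) (fibreIncl_decMap F a k).symm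

/-- The cofree functor `Cat // 𝒮 ⥤ Cat_ℓt // 𝒮`. -/
def cofreeFunctor : CatOver.{u} ⥤ LtCatOver.{u} where
  obj := cofree
  map F := ⟨decMap F, fun a h => by
    have h' : (⟨a.base, a.idx, a.base, 𝟙 a.base⟩ : DecObj _) = a := h
    rw [← h']
    exact congrArg (DecObj.mk _ _ _) (F.functor.map_id _).symm⟩
  map_id C := LtHom.ext' (decMap_id C)
  map_comp F G := LtHom.ext' (decMap_comp F G)

/-- The functor `X ↦ (u X, *, τ_X)`. -/
def decUnitFunctor (A : LtCatOver.{u}) : A.carrier ⥤ DecObj A.toCatOver where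
  obj := fun X => ⟨A.lt.u X, A.pt X, X, A.lt.τ X⟩
  map := fun {X Y} f => ⟨f, by
    refine DecObj.ext_heq (A.lt.u_eq f).symm rfl rfl ?_
    have h := A.lt.u_eq f
    change f ≫ A.lt.τ Y ≍ A.lt.τ X
    have := A.lt.τ_uniq ((f ≫ A.lt.τ Y) ≫ eqToHom h.symm)
    rw [← this]
    exact (comp_eqToHom_heq _ _).symm⟩
  map_id := fun _ => rfl
  map_comp := fun _ _ => rfl

/-- The unit: it sends `X` to `(u X, *, τ_X)`, and has as natural transformation
the evident identification of `|X|` with the only fibre of the map `|τ_X|` to a singleton. -/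
def decUnit (A : LtCatOver.{u}) : A ⟶ cofree A.toCatOver where
  hom :=
    { functor := decUnitFunctor A
      cell :=
        { app := fun X => FinOrd.ofFun fun k => fibreIndex (A.act (A.lt.τ X)) (A.pt X) k
            (A.el_u X _ _)
          naturality := fun X Y f => fibre_hom_ext fun k => by
            refine (fibreIncl_index _ _ _ (A.el_u Y _ _)).trans ?_
            refine Eq.trans ?_ (fibreIncl_fibreMap _ _ _ _ _
              (DecHom.act_eq ((decUnitFunctor A).map f)) _).symm
            exact congrArg (A.act f) (fibreIncl_index _ _ _ (A.el_u X _ _)).symm } }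
  isChosen X h := by
    have h' : A.lt.u X = X := h
    refine DecObj.ext_heq (a := ⟨A.lt.u X, A.pt X, A.lt.u X, 𝟙 _⟩)
      (b := ⟨A.lt.u X, A.pt X, X, A.lt.τ X⟩) rfl rfl h' ?_
    have := A.lt.τ_uniq (eqToHom h'.symm)
    change 𝟙 (A.lt.u X) ≍ A.lt.τ X
    rw [← this]
    exact (eqToHom_heq_id_cod X (A.lt.u X) h'.symm).symm

theorem fibreIncl_decUnit (A : LtCatOver.{u}) (X : A.carrier) (k : A.El X) :
    fibreIncl (A.act (A.lt.τ X)) (A.pt X) ((decUnit A).hom.relabel X k) = k :=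
  fibreIncl_index _ _ _ (A.el_u X _ _)

/-- The counit: it sends `(X, i, f : Y ⟶ X)` to `Y`, and its natural transformation has the
monotone injections `ε_{|f|,i} : |f|⁻¹(i) → |Y|` as components. -/
def decCounit (C : CatOver.{u}) : dec C ⟶ C where
  functor :=
    { obj := fun a => a.dom
      map := fun g => g.hom
      map_id := fun _ => rfl
      map_comp := fun _ _ => rfl }
  cell :=
    { app := fun a => FinOrd.ofFun (fibreIncl (C.act a.map) a.idx)
      naturality := fun _ _ g => funext fun k => fibreIncl_dec_act g k }

/-- Elements of the cardinalities of two equal objects agree when their images under the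
monotone injections do. -/
theorem dec_val_congr {C : CatOver.{u}} {a b : DecObj C} (hab : a = b) {k : (dec C).El a}
    {k' : (dec C).El b}
    (h : (fibreIncl (C.act a.map) a.idx k).val = (fibreIncl (C.act b.map) b.idx k').val) :
    k.val = k'.val := by
  subst hab
  exact congrArg Fin.val ((fibreIncl (C.act a.map) a.idx).injective (Fin.ext h))

theorem decUnit_naturality_obj {A B : LtCatOver.{u}} (F : A ⟶ B) (X : A.carrier) :
    (⟨B.lt.u (F.hom.functor.obj X), B.pt _, F.hom.functor.obj X, B.lt.τ _⟩ :
      DecObj B.toCatOver) =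
    ⟨F.hom.functor.obj (A.lt.u X), F.hom.relabel _ (A.pt X), F.hom.functor.obj X,
      F.hom.functor.map (A.lt.τ X)⟩ := by
  have hc : B.lt.u (F.hom.functor.obj (A.lt.u X)) = F.hom.functor.obj (A.lt.u X) :=
    F.isChosen _ (A.lt.isChosen_u X)
  have h : B.lt.u (F.hom.functor.obj X) = F.hom.functor.obj (A.lt.u X) :=
    (B.lt.u_eq (F.hom.functor.map (A.lt.τ X))).trans hc
  refine DecObj.ext_heq h ?_ rfl ?_
  · have hn : (B.card.obj (F.hom.functor.obj (A.lt.u X))).n = 1 := by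
      rw [← hc, B.card_u]
    have := (F.hom.relabel _ (A.pt X)).isLt
    change 0 = (F.hom.relabel _ (A.pt X)).val
    omega
  · have := B.lt.τ_uniq (F.hom.functor.map (A.lt.τ X) ≫ eqToHom h.symm)
    change B.lt.τ _ ≍ F.hom.functor.map (A.lt.τ X)
    rw [← this]
    simp

/-- The adjunction between the functor that forgets local terminal objects and the cofree
functor. Its induced comonad on `Cat // 𝒮` is modified décalage. -/
def decAdj : forgetLt.{u} ⊣ cofreeFunctor.{u} where
  unit :=
    { app := decUnit
      naturality := fun A B F => LtHom.ext' <| LaxHom.ext_val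
        (fun X => decUnit_naturality_obj F X)
        (fun {X Y} f => DecHom.heq (decUnit_naturality_obj F X) (decUnit_naturality_obj F Y)
          HEq.rfl)
        (fun X k => dec_val_congr (decUnit_naturality_obj F X) <| by
          refine (congrArg Fin.val
            (fibreIncl_decUnit B (F.hom.functor.obj X) (F.hom.relabel X k))).trans ?_
          refine Eq.trans ?_ (congrArg Fin.val (fibreIncl_decMap F.hom
            ((decUnit A).hom.functor.obj X) ((decUnit A).hom.relabel X k)).symm)
          exact congrArg Fin.val (congrArg (F.hom.relabel X) (fibreIncl_decUnit A X k).symm)) }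
  counit :=
    { app := decCounit
      naturality := fun C C' F => LaxHom.ext_val (fun _ => rfl) (fun _ => HEq.rfl)
        fun a k => congrArg Fin.val (fibreIncl_decMap F a k) }
  left_triangle_components A := LaxHom.ext_val (fun _ => rfl) (fun _ => HEq.rfl)
    fun X k => congrArg Fin.val (fibreIncl_decUnit A X k)
  right_triangle_components C := by
    have hobj : ∀ a : DecObj C, (⟨a.base, fibreIncl (C.act (𝟙 a.base)) a.idx
        ((cofree C).pt a), a.dom, a.map⟩ : DecObj C) = a := fun a => by
      refine DecObj.ext_heq rfl (congrArg Fin.val ?_) rfl HEq.rfl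
      exact (C.act_id _ _).symm.trans (apply_fibreIncl (C.act (𝟙 a.base)) a.idx _)
    refine LtHom.ext' <| LaxHom.ext_val hobj
      (fun {a b} g => DecHom.heq (hobj a) (hobj b) HEq.rfl)
      (fun a k => dec_val_congr (hobj a) ?_)
    refine (congrArg Fin.val (fibreIncl_decMap (decCounit C)
      ((decUnit (cofree C)).hom.functor.obj a) ((decUnit (cofree C)).hom.relabel a k))).trans ?_
    exact congrArg Fin.val
      (congrArg (fibreIncl (C.act a.map) a.idx) (fibreIncl_decUnit (cofree C) a k))

/-- The modified décalage comonad on the lax slice `Cat // 𝒮`. -/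
def decComonad : Comonad CatOver.{u} := decAdj.toComonad

/-- The modified décalage monad on the lax slice `Cat_ℓt // 𝒮`, induced by the forgetful-cofree
adjunction. -/
def laxDecMonad : Monad LtCatOver.{u} := decAdj.toMonad

/-! ### Restriction to the strict slice -/

/-- A morphism of the lax slice is strict when its natural transformation is an identity, so that
the triangle over `𝒮` commutes. -/
def strict : MorphismProperty LtCatOver.{u} := fun A B F =>
  ∃ h : A.card = F.hom.functor ⋙ B.card, F.hom.cell = eqToHom h

theorem eqToHom_val {a b : FinOrd} (h : a = b) (i : Fin a.n) :
    (FinOrd.toFun (eqToHom h) i).val = i.val := by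
  subst h; rfl

theorem strict_iff {A B : LtCatOver.{u}} (F : A ⟶ B) :
    strict F ↔ ∀ X, A.card.obj X = B.card.obj (F.hom.functor.obj X) ∧
      ∀ i, (F.hom.relabel X i).val = i.val := by
  constructor
  · rintro ⟨h, hc⟩ X
    refine ⟨Functor.congr_obj h X, fun i => ?_⟩
    unfold LaxHom.relabel
    rw [hc, eqToHom_app]
    exact eqToHom_val (Functor.congr_obj h X) i
  · intro H
    have hcomp : ∀ X, F.hom.cell.app X = eqToHom (H X).1 := fun X => by
      funext i
      exact Fin.ext (((H X).2 i).trans (eqToHom_val (H X).1 i).symm)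
    have h : A.card = F.hom.functor ⋙ B.card := by
      refine CategoryTheory.Functor.ext (fun X => (H X).1) fun X Y f => ?_
      have := F.hom.cell.naturality f
      rw [hcomp, hcomp] at this
      rw [← Category.assoc, ← this]
      simp
    refine ⟨h, ?_⟩
    ext X
    rw [hcomp, eqToHom_app]

instance : strict.{u}.IsMultiplicative where
  id_mem _ := ⟨rfl, rfl⟩
  comp_mem F G hF hG := by
    rw [strict_iff] at *
    exact fun X => ⟨(hF X).1.trans (hG _).1,
      fun i => ((hG _).2 (F.hom.relabel X i)).trans ((hF X).2 i)⟩

theorem strict_of_strictMono {A B : LtCatOver.{u}} (F : A ⟶ B)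
    (h : ∀ X, StrictMono (F.hom.relabel X) ∧ Function.Surjective (F.hom.relabel X)) :
    strict F := by
  rw [strict_iff]
  intro X
  obtain ⟨h1, h2⟩ := eq_of_strictMono (h X).1 (h X).2
  exact ⟨FinOrd.ext h1, h2⟩

/-- Modified décalage preserves strictness. -/
theorem strict_map {A B : LtCatOver.{u}} (F : A ⟶ B) (hF : strict F) :
    strict (laxDecMonad.map F) := by
  rw [strict_iff] at hF
  apply strict_of_strictMono
  intro (a : DecObj A.toCatOver)
  have key := fibreIncl_decMap F.hom a
  have hval := (hF a.dom).2
  have hcard := congrArg FinOrd.n (hF a.dom).1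
  constructor
  · intro k k' hk
    refine (fibreIncl (B.act (F.hom.functor.map a.map)) (F.hom.relabel a.base a.idx)).lt_iff_lt.mp ?_
    refine (key k).trans_lt (lt_of_lt_of_eq ?_ (key k').symm)
    rw [Fin.lt_def, hval, hval]
    exact (fibreIncl (A.act a.map) a.idx).strictMono hk
  · intro (k : Fin (fibre (B.act (F.hom.functor.map a.map)) (F.hom.relabel a.base a.idx)).n)
    let j := fibreIncl (B.act (F.hom.functor.map a.map)) (F.hom.relabel a.base a.idx) k
    let j' : A.El a.dom := ⟨j.val, by rw [hcard]; exact j.isLt⟩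
    have hj : F.hom.relabel a.dom j' = j := Fin.ext (hval j')
    have hj' : A.act a.map j' = a.idx := by
      have h1 := F.hom.relabel_act a.map j'
      rw [hj] at h1
      have h2 := h1.trans (apply_fibreIncl _ _ k)
      have h3 := congrArg Fin.val h2
      rw [(hF a.base).2, (hF a.base).2] at h3
      exact Fin.ext h3
    refine ⟨fibreIndex (A.act a.map) a.idx j' hj', ?_⟩
    apply (fibreIncl (B.act (F.hom.functor.map a.map)) (F.hom.relabel a.base a.idx)).injective
    refine (key _).trans ?_
    rw [fibreIncl_index, hj]

theorem strict_unit (A : LtCatOver.{u}) : strict (laxDecMonad.η.app A) := by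
  apply strict_of_strictMono
  intro X
  have key := fibreIncl_decUnit A X
  constructor
  · intro k k' hk
    refine (fibreIncl (A.act (A.lt.τ X)) (A.pt X)).lt_iff_lt.mp ?_
    refine (key k).trans_lt (lt_of_lt_of_eq ?_ (key k').symm)
    exact hk
  · intro (k : Fin (fibre (A.act (A.lt.τ X)) (A.pt X)).n)
    refine ⟨fibreIncl (A.act (A.lt.τ X)) (A.pt X) k, ?_⟩
    apply (fibreIncl (A.act (A.lt.τ X)) (A.pt X)).injective
    exact key _

theorem strict_mult (A : LtCatOver.{u}) : strict (laxDecMonad.μ.app A) := by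
  apply strict_of_strictMono
  intro (a : DecObj (dec A.toCatOver))
  have key := fibreIncl_decMap (decCounit A.toCatOver) a
  let ι := fibreIncl (A.act a.map.hom) (fibreIncl (A.act a.base.map) a.base.idx a.idx)
  constructor
  · intro k k' hk
    refine ι.lt_iff_lt.mp ?_
    refine (key k).trans_lt (lt_of_lt_of_eq ?_ (key k').symm)
    exact (fibreIncl (A.act a.dom.map) a.dom.idx).strictMono
      ((fibreIncl ((dec A.toCatOver).act a.map) a.idx).strictMono hk)
  · intro (k : Fin (fibre (A.act a.map.hom)
      (fibreIncl (A.act a.base.map) a.base.idx a.idx)).n)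
    have h1 : A.act a.map.hom (ι k) = fibreIncl (A.act a.base.map) a.base.idx a.idx :=
      apply_fibreIncl _ _ k
    have h2 : A.act a.dom.map (ι k) = a.dom.idx := by
      refine DecHom.act_eq' a.map (ι k) ?_
      exact (congrArg (A.act a.base.map) h1).trans (apply_fibreIncl _ _ _)
    let k1 : (dec A.toCatOver).El a.dom := fibreIndex (A.act a.dom.map) a.dom.idx (ι k) h2
    have h3 : (dec A.toCatOver).act a.map k1 = a.idx := by
      apply (fibreIncl (A.act a.base.map) a.base.idx).injective
      refine (fibreIncl_dec_act a.map k1).trans ?_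
      refine (congrArg (A.act a.map.hom) (fibreIncl_index _ _ _ _)).trans h1
    refine ⟨fibreIndex ((dec A.toCatOver).act a.map) a.idx k1 h3, ?_⟩
    apply ι.injective
    refine (key _).trans ?_
    refine (congrArg (fibreIncl (A.act a.dom.map) a.dom.idx) (fibreIncl_index _ _ _ _)).trans ?_
    exact fibreIncl_index _ _ _ _

/-- The strict slice category `Cat_ℓt / 𝒮`: same objects as the lax slice, and its strict
morphisms. -/
abbrev StrictSlice : Type (u + 1) := WideSubcategory strict.{u}

/-- The modified décalage monad on the strict slice `Cat_ℓt / 𝒮`: the restriction of the one on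
the lax slice. -/
def decMonad : Monad StrictSlice.{u} where
  obj A := ⟨laxDecMonad.obj A.obj⟩
  map F := ⟨laxDecMonad.map F.hom, strict_map F.hom F.property⟩
  map_id A := WideSubcategory.hom_ext _ (laxDecMonad.map_id A.obj)
  map_comp F G := WideSubcategory.hom_ext _ (laxDecMonad.map_comp F.hom G.hom)
  η :=
    { app := fun A => ⟨laxDecMonad.η.app A.obj, strict_unit A.obj⟩
      naturality := fun _ _ F => WideSubcategory.hom_ext _ (laxDecMonad.η.naturality F.hom) }
  μ :=
    { app := fun A => ⟨laxDecMonad.μ.app A.obj, strict_mult A.obj⟩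
      naturality := fun _ _ F => WideSubcategory.hom_ext _ (laxDecMonad.μ.naturality F.hom) }
  assoc A := WideSubcategory.hom_ext _ (laxDecMonad.assoc A.obj)
  left_unit A := WideSubcategory.hom_ext _ (laxDecMonad.left_unit A.obj)
  right_unit A := WideSubcategory.hom_ext _ (laxDecMonad.right_unit A.obj)

/-! ### Operadic categories -/

/-- An operadic category. The underlying `LtCatOver` consists of a small category with local
terminal objects and a cardinality functor sending each of these to `1`. Equality of morphisms
with possibly different (provably equal) ends is expressed as equality in the set of all arrows
of the category. -/
structure OperadicCategory : Type (u + 1) extends LtCatOver.{u} where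
  /-- the fibre functor: `(fib X i).obj f` is the fibre `f⁻¹(i)`, and `(fib X i).map g` is the
  fibre map `g^f_i : (f g)⁻¹(i) ⟶ f⁻¹(i)` -/
  fib : ∀ (X : carrier) (_ : Fin (card.obj X).n), Over X ⥤ carrier
  /-- the fibres of identities are chosen terminal objects -/
  fib_id : ∀ X i, lt.IsChosen ((fib X i).obj (Over.mk (𝟙 X)))
  /-- `|f⁻¹(i)| = |f|⁻¹(i)` -/
  card_fib : ∀ X i (f : Over X),
    card.obj ((fib X i).obj f) = fibre (toCatOver.act f.hom) i
  /-- `|g^f_i| = |g|^|f|_i` -/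
  card_fib_map : ∀ X i {f' f : Over X} (g : f' ⟶ f),
    Arrow.mk (card.map ((fib X i).map g)) =
      Arrow.mk (fibreMap (toCatOver.act g.left) (toCatOver.act f'.hom) i
        (toCatOver.act f.hom) i
        (fun j hj => by rw [← CatOver.act_comp, Over.w]; exact hj))
  /-- `τ_X⁻¹(*) = X` -/
  fib_τ : ∀ X, (fib (lt.u X) (toLtCatOver.pt X)).obj (Over.mk (lt.τ X)) = X
  /-- `f^{τ_X}_* = f` -/
  fib_τ_map : ∀ {Y X : carrier} (f : Y ⟶ X),
    Arrow.mk ((fib (lt.u X) (toLtCatOver.pt X)).map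
      (Over.homMk f : Over.mk (f ≫ lt.τ X) ⟶ Over.mk (lt.τ X))) = Arrow.mk f
  /-- `(g^f_i)⁻¹(j) = g⁻¹(ε j)` for `j ∈ |f|⁻¹(i)` -/
  fib_fib : ∀ X i {f' f : Over X} (g : f' ⟶ f) (j : Fin (fibre (toCatOver.act f.hom) i).n),
    (fib ((fib X i).obj f) (j.cast (congrArg FinOrd.n (card_fib X i f).symm))).obj
        (Over.mk ((fib X i).map g)) =
      (fib f.left (fibreIncl (toCatOver.act f.hom) i j)).obj (Over.mk g.left)
  /-- `(h^{f g}_i)^{g^f_i}_j = h^g_{ε j}` for `j ∈ |f|⁻¹(i)` -/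
  fib_fib_map : ∀ X i {f'' f' f : Over X} (h : f'' ⟶ f') (g : f' ⟶ f)
    (j : Fin (fibre (toCatOver.act f.hom) i).n),
    Arrow.mk ((fib ((fib X i).obj f) (j.cast (congrArg FinOrd.n (card_fib X i f).symm))).map
        (Over.homMk ((fib X i).map h) ((fib X i).map_comp h g).symm :
          Over.mk ((fib X i).map (h ≫ g)) ⟶ Over.mk ((fib X i).map g))) =
      Arrow.mk ((fib f.left (fibreIncl (toCatOver.act f.hom) i j)).map
        (Over.homMk h.left : Over.mk (h ≫ g).left ⟶ Over.mk g.left))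

/-- An operadic functor: it preserves the chosen terminal objects, strictly commutes with the
cardinality functors, and preserves fibres and fibre maps. -/
structure OperadicFunctor (A B : OperadicCategory.{u}) where
  /-- the underlying functor -/
  functor : A.carrier ⥤ B.carrier
  isChosen : ∀ X, A.lt.IsChosen X → B.lt.IsChosen (functor.obj X)
  card_eq : A.card = functor ⋙ B.card
  /-- `F (f⁻¹(i)) = (F f)⁻¹(i)` -/
  fib_obj : ∀ X i (f : Over X), functor.obj ((A.fib X i).obj f) =
    (B.fib (functor.obj X)
      (i.cast (congrArg FinOrd.n (Functor.congr_obj card_eq X)))).obj ((Over.post functor).obj f)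
  /-- `F (g^f_i) = (F g)^{F f}_i` -/
  fib_map : ∀ X i {f' f : Over X} (g : f' ⟶ f),
    Arrow.mk (functor.map ((A.fib X i).map g)) =
      Arrow.mk ((B.fib (functor.obj X)
        (i.cast (congrArg FinOrd.n (Functor.congr_obj card_eq X)))).map
          ((Over.post functor).map g))

/-- The category of operadic categories and operadic functors. -/
instance : Category.{u} OperadicCategory.{u} where
  Hom := OperadicFunctor
  id _ :=
    { functor := 𝟭 _
      isChosen := fun _ h => h
      card_eq := rfl
      fib_obj := fun _ _ _ => rfl
      fib_map := fun _ _ _ _ _ => rfl }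
  comp F G :=
    { functor := F.functor ⋙ G.functor
      isChosen := fun X h => G.isChosen _ (F.isChosen X h)
      card_eq := F.card_eq.trans (congrArg (F.functor ⋙ ·) G.card_eq)
      fib_obj := fun X i f =>
        (congrArg G.functor.obj (F.fib_obj X i f)).trans (G.fib_obj _ _ _)
      fib_map := fun X i _ _ g =>
        (congrArg G.functor.mapArrow.obj (F.fib_map X i g)).trans (G.fib_map _ _ _) }
  id_comp _ := rfl
  comp_id _ := rfl
  assoc _ _ _ := rfl

end Decalage

namespace Decalage

/-! ### Strict morphisms are determined by their functors -/

/-! As a category, the modified décalage of `C` is the coproduct of the slices `C / X` over all `X`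
and `i ∈ |X|`. A functor `R` from it to `C` is therefore the same thing as a family of functors `C /
X ⥤ C`, with no further data or conditions; `assemble` and restriction along `sliceIncl` are
mutually inverse.

Under this bijection the conditions on an algebra match the axioms of an operadic category one by
one. A strict morphism is determined by its functor, so being a morphism of the strict slice means
that `R` preserves chosen terminals (fibres of identities are chosen terminal) and commutes with
cardinalities (`|f⁻¹(i)| = |f|⁻¹(i)`, `|g^f_i| = |g|^|f|_i`). The unit sends `X` to `(uX, *, τ_X)`,
so the unit law is the axiom on fibres of `τ_X`. The multiplication is décalage of the counit, so
the associativity law compares the fibre of `g` at `ε j` with the fibre of `g^f_i` at `j`, which is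
the double fibre axiom. A strict morphism commutes with structure maps exactly when it preserves
fibres and fibre maps.

Both round trips fix the underlying category with its cardinality and terminals, and restore the
fibre functors exactly, hence an isomorphism. Since many equations have ends that agree only
propositionally, functors are compared through their action on the set of all arrows
(`Arrow.functor_ext`); an equation there includes the equations between the ends. -/

theorem lax_ext_of_eqToHom {A B : CatOver.{u}} {F G : LaxHom A B}
    (hF : ∃ h : A.card = F.functor ⋙ B.card, F.cell = eqToHom h)
    (hG : ∃ h : A.card = G.functor ⋙ B.card, G.cell = eqToHom h)
    (h : F.functor = G.functor) : F = G := by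
  obtain ⟨F, ν⟩ := F
  obtain ⟨G, ν'⟩ := G
  obtain rfl : F = G := h
  obtain ⟨_, h1⟩ := hF
  obtain ⟨_, h2⟩ := hG
  exact congrArg (LaxHom.mk F) (h1.trans h2.symm)

/-- The cell of a strict morphism is `eqToHom` of a proposition, so it carries no data. This reduces
every algebra law to an equation between functors. -/
theorem strictSlice_hom_ext {A B : StrictSlice.{u}} {F G : A ⟶ B}
    (h : F.hom.hom.functor = G.hom.hom.functor) : F = G :=
  WideSubcategory.hom_ext _ (LtHom.ext' (lax_ext_of_eqToHom F.property G.property h))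

/-- The strict morphism with a given functor that commutes with the cardinality functors. -/
def strictHom {A B : LtCatOver.{u}} (F : A.carrier ⥤ B.carrier)
    (hF : ∀ X, A.lt.IsChosen X → B.lt.IsChosen (F.obj X)) (h : A.card = F ⋙ B.card) :
    (⟨A⟩ : StrictSlice.{u}) ⟶ ⟨B⟩ :=
  ⟨⟨⟨F, eqToHom h⟩, hF⟩, ⟨h, rfl⟩⟩

theorem strict.card_eq {A B : LtCatOver.{u}} {F : A ⟶ B} (hF : strict F) :
    A.card = F.hom.functor ⋙ B.card := hF.1

/-- Algebras move indices along cells, whereas the operadic axioms move them by `Fin.cast`; for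
strict morphisms the two agree. -/
theorem strict.relabel_eq {A B : LtCatOver.{u}} {F : A ⟶ B} (hF : strict F) (X : A.carrier)
    (i : A.El X) (h : (A.card.obj X).n = (B.card.obj (F.hom.functor.obj X)).n) :
    F.hom.relabel X i = i.cast h :=
  Fin.ext (((strict_iff F).1 hF X).2 i)

/-! ### Arrows of modified décalage -/

/-- The inclusion of the summand `C / X` indexed by `i ∈ |X|` into modified décalage. -/
def sliceIncl (C : CatOver.{u}) (X : C.carrier) (i : C.El X) : Over X ⥤ DecObj C where
  obj f := ⟨X, i, f.left, f.hom⟩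
  map g := ⟨g.left, congrArg (DecObj.mk X i _) (Over.w g)⟩
  map_id _ := rfl
  map_comp _ _ := rfl

/-- The commuting triangle `w` recovers the source from the target and the underlying morphism, so
no comparison of sources is needed beyond that of their domains. -/
theorem DecHom.arrow_ext {C : CatOver.{u}} {a b a' b' : DecObj C} {g : a ⟶ b} {g' : a' ⟶ b'}
    (hb : b = b') (h : Arrow.mk g.hom = Arrow.mk g'.hom) : Arrow.mk g = Arrow.mk g' := by
  subst hb
  obtain ⟨X, i, Y, f⟩ := a
  obtain ⟨X', i', Y', f'⟩ := a'
  obtain ⟨g, w⟩ := (g : DecHom _ b)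
  obtain ⟨g', w'⟩ := (g' : DecHom _ b)
  dsimp only at g w g' w'
  cases w
  cases w'
  obtain ⟨h1, _, h2⟩ := (Arrow.mk_eq_mk_iff _ _).1 h
  obtain rfl : Y = Y' := h1
  obtain rfl : g = g' := by simpa using h2
  rfl

/-- An arrow of modified décalage, on its normal form. -/
theorem DecHom.arrow_eq_sliceIncl {C : CatOver.{u}} {a b : DecObj C} (g : a ⟶ b) :
    Arrow.mk g = Arrow.mk ((sliceIncl C b.base b.idx).map
      (Over.homMk g.hom : Over.mk (g.hom ≫ b.map) ⟶ Over.mk b.map)) :=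
  DecHom.arrow_ext rfl rfl

theorem arrow_map_congr {C D : Type*} [Category* C] [Category* D] (F : C ⥤ D) {X Y X' Y' : C}
    {f : X ⟶ Y} {f' : X' ⟶ Y'} (h : Arrow.mk f = Arrow.mk f') :
    Arrow.mk (F.map f) = Arrow.mk (F.map f') :=
  congrArg F.mapArrow.obj h

theorem arrow_map_of_eq {C D : Type*} [Category* C] [Category* D] {F G : C ⥤ D} (h : F = G)
    {X Y : C} (f : X ⟶ Y) : Arrow.mk (F.map f) = Arrow.mk (G.map f) := by
  subst h; rfl

theorem heq_of_arrow_eq {C : Type*} [Category* C] {X Y X' Y' : C} {f : X ⟶ Y} {f' : X' ⟶ Y'}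
    (h : Arrow.mk f = Arrow.mk f') : X = X' ∧ f ≍ f' := by
  obtain ⟨h1, h2, h3⟩ := (Arrow.mk_eq_mk_iff _ _).1 h
  exact ⟨h1, (conj_eqToHom_iff_heq f f' h1 h2).1 h3⟩

/-! ### Functors out of modified décalage -/

section Assemble

variable {C : CatOver.{u}} {D : Type u} [Category.{u} D]

/-- The functor on modified décalage assembled from functors on the slices. -/
def assemble (fib : ∀ (X : C.carrier) (_ : C.El X), Over X ⥤ D) : DecObj C ⥤ D where
  obj a := (fib a.base a.idx).obj (Over.mk a.map)
  map {a b} g := eqToHom (congrArg (fun a : DecObj C => (fib a.base a.idx).obj (Over.mk a.map))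
      g.w.symm) ≫
    (fib b.base b.idx).map (Over.homMk g.hom : Over.mk (g.hom ≫ b.map) ⟶ Over.mk b.map)
  map_id a := by
    rw [eqToHom_comp_iff]
    obtain ⟨X, i, Y, f⟩ := a
    change (fib X i).map (Over.homMk (𝟙 Y) : Over.mk (𝟙 Y ≫ f) ⟶ Over.mk f) = _
    -- The source `Over.mk (𝟙 Y ≫ f)` is not syntactically `Over.mk f`. Replacing its structure map
    -- by a variable `f'` allows the equation to be substituted.
    have key : ∀ (f' : Y ⟶ X) (h : f' = f) (w : 𝟙 Y ≫ f = f'),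
        (fib X i).map (Over.homMk (𝟙 Y) w : Over.mk f' ⟶ Over.mk f) =
          eqToHom (by rw [h]) := by
      rintro _ rfl w
      exact (fib X i).map_id _
    rw [key _ (Category.id_comp f) rfl]
    simp
  map_comp {a b c} g h := by
    obtain ⟨X, i, Y, _⟩ := a
    obtain ⟨_, _, Y', _⟩ := b
    obtain ⟨_, _, Z, f⟩ := c
    obtain ⟨g, w⟩ := (g : DecHom _ _)
    obtain ⟨h, w'⟩ := (h : DecHom _ _)
    dsimp only at g w h w'
    -- Both sources take their normal form, so the transports for `g` and `h` vanish; the one for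
    -- the composite remains and accounts for associativity.
    cases w'
    cases w
    rw [eqToHom_refl, eqToHom_refl, Category.id_comp, Category.id_comp, eqToHom_comp_iff]
    change (fib X i).map (Over.homMk (g ≫ h) : Over.mk ((g ≫ h) ≫ f) ⟶ Over.mk f) =
      eqToHom _ ≫ (fib X i).map (Over.homMk g : Over.mk (g ≫ h ≫ f) ⟶ Over.mk (h ≫ f)) ≫
        (fib X i).map (Over.homMk h : Over.mk (h ≫ f) ⟶ Over.mk f)
    rw [← Functor.map_comp]
    have key : ∀ (f' : Y ⟶ X) (e : f' = g ≫ h ≫ f) (w : (g ≫ h) ≫ f = f'),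
        (fib X i).map (Over.homMk (g ≫ h) w : Over.mk f' ⟶ Over.mk f) =
          eqToHom (by rw [e]) ≫ (fib X i).map
            ((Over.homMk g : Over.mk (g ≫ h ≫ f) ⟶ Over.mk (h ≫ f)) ≫
                (Over.homMk h : Over.mk (h ≫ f) ⟶ Over.mk f)) := by
      rintro _ rfl w
      rw [eqToHom_refl, Category.id_comp]
      rfl
    exact key _ (Category.assoc g h f) rfl

/-- Composing with `eqToHom` does not change an element of the set of arrows, so the transport in
`assemble` disappears. -/
theorem arrow_assemble_map (fib : ∀ (X : C.carrier) (_ : C.El X), Over X ⥤ D) {a b : DecObj C}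
    (g : a ⟶ b) :
    Arrow.mk ((assemble fib).map g) = Arrow.mk ((fib b.base b.idx).map
      (Over.homMk g.hom : Over.mk (g.hom ≫ b.map) ⟶ Over.mk b.map)) :=
  Arrow.arrow_mk_eqToHom_comp _ _

theorem Over.arrow_homMk_left {T : Type*} [Category* T] {X : T} {f' f : Over X} (g : f' ⟶ f) :
    Arrow.mk (Over.homMk g.left : Over.mk (g.left ≫ f.hom) ⟶ f) = Arrow.mk g := by
  have key : ∀ (k : f'.left ⟶ X) (_ : f'.hom = k) (w : g.left ≫ f.hom = k),
      Arrow.mk (Over.homMk g.left w : Over.mk k ⟶ f) = Arrow.mk g := by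
    rintro _ rfl w
    rfl
  exact key _ (Over.w g).symm rfl

/-- With `assemble_sliceIncl_comp`, this is the universal property of the coproduct of slices, as a
bijection with strict equality of functors. -/
theorem sliceIncl_comp_assemble (fib : ∀ (X : C.carrier) (_ : C.El X), Over X ⥤ D)
    (X : C.carrier) (i : C.El X) : sliceIncl C X i ⋙ assemble fib = fib X i :=
  Arrow.functor_ext fun _ _ g => (arrow_assemble_map fib _).trans
    (arrow_map_congr (fib X i) (Over.arrow_homMk_left g))

theorem assemble_sliceIncl_comp (R : DecObj C ⥤ D) :
    assemble (fun X i => sliceIncl C X i ⋙ R) = R :=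
  Arrow.functor_ext fun _ _ g => (arrow_assemble_map _ g).trans
    (arrow_map_congr R (DecHom.arrow_eq_sliceIncl g).symm)

end Assemble

/-! ### Algebras as functors -/

section Algebra

variable (P : decMonad.{u}.Algebra)

/-- The structure functor of an algebra. -/
def algFunctor : DecObj P.A.obj.toCatOver ⥤ P.A.obj.carrier := P.a.hom.hom.functor

theorem algFunctor_isChosen (a : DecObj P.A.obj.toCatOver) (h : (decLt _).IsChosen a) :
    P.A.obj.lt.IsChosen ((algFunctor P).obj a) := P.a.hom.isChosen a h

theorem algFunctor_card : (dec P.A.obj.toCatOver).card = algFunctor P ⋙ P.A.obj.card :=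
  P.a.property.card_eq

theorem algFunctor_unit : decUnitFunctor P.A.obj ⋙ algFunctor P = 𝟭 _ :=
  congrArg (fun F : P.A ⟶ P.A => F.hom.hom.functor) P.unit

/-- On an object `(f, j, g)` of the double décalage, with `f : Y ⟶ X`, the left side first forms
`(Y, ε j, g)` and the right side first forms `(R f, j, R g)`, up to the identification of `|f|⁻¹(i)`
with `|R f|`. -/
theorem algFunctor_assoc :
    decMapFunctor (decCounit P.A.obj.toCatOver) ⋙ algFunctor P =
      decMapFunctor P.a.hom.hom ⋙ algFunctor P :=
  congrArg (fun F : (decMonad.{u}.obj (decMonad.{u}.obj P.A)) ⟶ P.A => F.hom.hom.functor) P.assoc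

theorem algFunctor_hom {P Q : decMonad.{u}.Algebra} (F : P ⟶ Q) :
    decMapFunctor F.f.hom.hom ⋙ algFunctor Q = algFunctor P ⋙ F.f.hom.hom.functor :=
  congrArg (fun F : decMonad.{u}.obj P.A ⟶ Q.A => F.hom.hom.functor) F.h

/-- The algebra with a given structure functor. -/
def mkAlgebra (A : LtCatOver.{u}) (R : DecObj A.toCatOver ⥤ A.carrier)
    (hR : ∀ a, (decLt _).IsChosen a → A.lt.IsChosen (R.obj a))
    (hcard : (dec A.toCatOver).card = R ⋙ A.card)
    (hunit : decUnitFunctor A ⋙ R = 𝟭 _)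
    (hassoc : decMapFunctor (decCounit A.toCatOver) ⋙ R =
      decMapFunctor (C := dec A.toCatOver) (C' := A.toCatOver) ⟨R, eqToHom hcard⟩ ⋙ R) :
    decMonad.{u}.Algebra where
  A := ⟨A⟩
  a := strictHom (A := cofree A.toCatOver) (B := A) R hR hcard
  unit := strictSlice_hom_ext hunit
  assoc := strictSlice_hom_ext hassoc

theorem algebra_ext {A : StrictSlice.{u}} {a b : decMonad.{u}.obj A ⟶ A} {ha ha' hb hb'}
    (h : a.hom.hom.functor = b.hom.hom.functor) :
    (⟨A, a, ha, ha'⟩ : decMonad.{u}.Algebra) = ⟨A, b, hb, hb'⟩ := by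
  obtain rfl : a = b := strictSlice_hom_ext h
  rfl

end Algebra

/-! ### From algebras to operadic categories -/

/-- The operadic category underlying an algebra: the fibre functors are the restrictions of the
structure functor to the slices. -/
def operadicOfAlgebra (P : decMonad.{u}.Algebra) : OperadicCategory.{u} where
  toLtCatOver := P.A.obj
  fib X i := sliceIncl P.A.obj.toCatOver X i ⋙ algFunctor P
  fib_id X i := algFunctor_isChosen P ⟨X, i, X, 𝟙 X⟩ rfl
  card_fib X i f := (Functor.congr_obj (algFunctor_card P) ((sliceIncl _ X i).obj f)).symm
  card_fib_map X i _ _ g :=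
    (arrow_map_of_eq (algFunctor_card P) ((sliceIncl _ X i).map g)).symm
  fib_τ X := Functor.congr_obj (algFunctor_unit P) X
  fib_τ_map f := by
    refine Eq.trans ?_ (arrow_map_of_eq (algFunctor_unit P) f)
    -- The unit takes `f : Y ⟶ X` to an arrow out of `(uY, *, τ_Y)`, while the axiom starts from
    -- `(uX, *, f ≫ τ_X)`; target and underlying morphism coincide.
    exact arrow_map_congr (algFunctor P) (DecHom.arrow_ext rfl rfl)
  fib_fib X i f' f g j := by
    -- The object of the double décalage at which associativity becomes the double fibre axiom.
    let x : DecObj (dec P.A.obj.toCatOver) :=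
      ⟨(sliceIncl _ X i).obj f, j, (sliceIncl _ X i).obj f', (sliceIncl _ X i).map g⟩
    refine Eq.trans ?_ (Functor.congr_obj (algFunctor_assoc P) x).symm
    exact congrArg (fun k => (algFunctor P).obj
        ⟨(algFunctor P).obj x.base, k, (algFunctor P).obj x.dom, (algFunctor P).map x.map⟩)
      (strict.relabel_eq P.a.property x.base j _).symm
  fib_fib_map X i f'' f' f h g j := by
    let x : DecObj (dec P.A.obj.toCatOver) :=
      ⟨(sliceIncl _ X i).obj f, j, (sliceIncl _ X i).obj f', (sliceIncl _ X i).map g⟩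
    let y : DecObj (dec P.A.obj.toCatOver) :=
      ⟨(sliceIncl _ X i).obj f, j, (sliceIncl _ X i).obj f'', (sliceIncl _ X i).map (h ≫ g)⟩
    -- Associativity on this arrow is the double fibre axiom for the fibre maps of `h`.
    let k : y ⟶ x := ⟨(sliceIncl _ X i).map h, rfl⟩
    refine Eq.trans ?_ ((arrow_map_of_eq (algFunctor_assoc P) k).symm.trans ?_)
    · refine arrow_map_congr (algFunctor P) (DecHom.arrow_ext ?_ rfl)
      exact congrArg (fun k => (⟨(algFunctor P).obj x.base, k, (algFunctor P).obj x.dom,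
        (algFunctor P).map x.map⟩ : DecObj _)) (strict.relabel_eq P.a.property x.base j _).symm
    · exact arrow_map_congr (algFunctor P) (DecHom.arrow_ext rfl rfl)

/-- The operadic functor underlying a morphism of algebras. -/
def operadicOfAlgebraMap {P Q : decMonad.{u}.Algebra} (F : P ⟶ Q) :
    operadicOfAlgebra P ⟶ operadicOfAlgebra Q :=
  OperadicFunctor.mk (A := operadicOfAlgebra P) (B := operadicOfAlgebra Q)
    F.f.hom.hom.functor F.f.hom.isChosen F.f.property.card_eq
    (fun X i f => by
      refine (Functor.congr_obj (algFunctor_hom F) ((sliceIncl _ X i).obj f)).symm.trans ?_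
      exact congrArg (fun k => (algFunctor Q).obj ⟨F.f.hom.hom.functor.obj X, k,
        F.f.hom.hom.functor.obj f.left, F.f.hom.hom.functor.map f.hom⟩)
        (strict.relabel_eq F.f.property _ i _))
    (fun X i f' f g => by
      refine (arrow_map_of_eq (algFunctor_hom F) ((sliceIncl _ X i).map g)).symm.trans ?_
      refine arrow_map_congr (algFunctor Q) (DecHom.arrow_ext ?_ rfl)
      exact congrArg (fun k => (⟨F.f.hom.hom.functor.obj X, k,
        F.f.hom.hom.functor.obj f.left, F.f.hom.hom.functor.map f.hom⟩ : DecObj _))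
        (strict.relabel_eq F.f.property _ i _))

theorem OperadicFunctor.ext_functor {A B : OperadicCategory.{u}} {F G : A ⟶ B}
    (h : OperadicFunctor.functor F = OperadicFunctor.functor G) : F = G := by
  obtain ⟨F, _, _, _, _⟩ := (F : OperadicFunctor A B)
  obtain ⟨G, _, _, _, _⟩ := (G : OperadicFunctor A B)
  obtain rfl : F = G := h
  rfl

/-- The functor from algebras to operadic categories. -/
def algebraToOperadic : decMonad.{u}.Algebra ⥤ OperadicCategory.{u} where
  obj := operadicOfAlgebra
  map := operadicOfAlgebraMap
  map_id _ := rfl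
  map_comp _ _ := rfl

/-! ### From operadic categories to algebras -/

theorem arrow_fib_map (O : OperadicCategory.{u}) {X : O.carrier} {i : O.toCatOver.El X}
    {f' f : Over X} (g : f' ⟶ f) :
    Arrow.mk ((O.fib X i).map g) =
      Arrow.mk ((assemble (C := O.toCatOver) O.fib).map ((sliceIncl O.toCatOver X i).map g)) :=
  arrow_map_of_eq (sliceIncl_comp_assemble (C := O.toCatOver) O.fib X i).symm g

theorem assemble_isChosen (O : OperadicCategory.{u}) (a : DecObj O.toCatOver)
    (h : (decLt _).IsChosen a) : O.lt.IsChosen ((assemble (C := O.toCatOver) O.fib).obj a) := by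
  have h' : (⟨a.base, a.idx, a.base, 𝟙 a.base⟩ : DecObj O.toCatOver) = a := h
  rw [← h']
  exact O.fib_id a.base a.idx

/-- Every arrow of décalage has a normal form inside one slice, and there the claim is
`card_fib_map`. -/
theorem assemble_card (O : OperadicCategory.{u}) :
    (dec O.toCatOver).card = assemble (C := O.toCatOver) O.fib ⋙ O.card :=
  Arrow.functor_ext fun _ b g =>
    (arrow_map_congr (dec O.toCatOver).card (DecHom.arrow_eq_sliceIncl g)).trans <|
      (O.card_fib_map b.base b.idx _).symm.trans
        (arrow_map_congr O.card (arrow_assemble_map (C := O.toCatOver) O.fib g)).symm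

/-- The normal form of the unit on `f` is the triangle `f : f ≫ τ_X ⟶ τ_X`, to which `fib_τ_map`
applies. -/
theorem assemble_unit (O : OperadicCategory.{u}) :
    decUnitFunctor O.toLtCatOver ⋙ assemble (C := O.toCatOver) O.fib = 𝟭 _ :=
  Arrow.functor_ext fun _ _ f => (arrow_assemble_map (C := O.toCatOver) O.fib _).trans
    (O.fib_τ_map f)

theorem eqToHom_relabel {A B : CatOver.{u}} {F : A.carrier ⥤ B.carrier}
    (h : A.card = F ⋙ B.card) (X : A.carrier) (i : A.El X)
    (h' : (A.card.obj X).n = (B.card.obj (F.obj X)).n) :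
    LaxHom.relabel (A := A) (B := B) ⟨F, eqToHom h⟩ X i = i.cast h' := by
  apply Fin.ext
  change (FinOrd.toFun ((eqToHom h).app X) i).val = _
  rw [eqToHom_app]
  exact eqToHom_val _ i

theorem assemble_assoc (O : OperadicCategory.{u}) :
    decMapFunctor (decCounit O.toCatOver) ⋙ assemble (C := O.toCatOver) O.fib =
      decMapFunctor (C := dec O.toCatOver) (C' := O.toCatOver)
        ⟨assemble (C := O.toCatOver) O.fib, eqToHom (assemble_card O)⟩ ⋙
          assemble (C := O.toCatOver) O.fib := by
  let R := assemble (C := O.toCatOver) O.fib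
  refine Arrow.functor_ext ?_
  intro x y h
  obtain ⟨⟨X, i, Y, f⟩, j, c, g⟩ := y
  obtain ⟨_, _, Z, _⟩ := c
  -- Only the underlying morphism of `h` and its target matter for equality of arrows, so its source
  -- is not normalised; `cases w` below does this for the middle object.
  obtain ⟨h, -⟩ := h
  obtain ⟨g, w⟩ := g
  dsimp only at g w h
  cases w
  let g' : Over.mk (g ≫ f) ⟶ Over.mk f := Over.homMk g
  let h' : Over.mk (h.hom ≫ g ≫ f) ⟶ Over.mk (g ≫ f) := Over.homMk h.hom
  refine (arrow_assemble_map (C := O.toCatOver) O.fib _).trans ?_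
  refine (O.fib_fib_map X i h' g' j).symm.trans ?_
  -- Both sides are now `R` of an arrow of décalage. Their targets agree because `R` sends `g` to
  -- the fibre map of `g'` and the identity cell acts on `j` as the cast.
  refine (arrow_fib_map O _).trans (arrow_map_congr R (DecHom.arrow_ext ?_ ?_))
  · obtain ⟨h1, h2⟩ := heq_of_arrow_eq (arrow_assemble_map (C := O.toCatOver) O.fib
      (a := ⟨X, i, Z, g ≫ f⟩) (b := ⟨X, i, Y, f⟩) ⟨g, rfl⟩)
    refine DecObj.ext_heq rfl ?_ h1.symm h2.symm
    exact congrArg Fin.val (eqToHom_relabel (assemble_card O) _ _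
      (congrArg FinOrd.n (O.card_fib X i (Over.mk f)).symm)).symm
  · exact (arrow_assemble_map (C := O.toCatOver) O.fib h).symm

/-- The algebra underlying an operadic category: the structure functor is assembled from the fibre
functors. -/
def algebraOfOperadic (O : OperadicCategory.{u}) : decMonad.{u}.Algebra :=
  mkAlgebra O.toLtCatOver (assemble (C := O.toCatOver) O.fib) (assemble_isChosen O)
    (assemble_card O) (assemble_unit O) (assemble_assoc O)

theorem assemble_naturality {O O' : OperadicCategory.{u}} (G : OperadicFunctor O O') :
    decMapFunctor (C := O.toCatOver) (C' := O'.toCatOver) ⟨G.functor, eqToHom G.card_eq⟩ ⋙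
        assemble (C := O'.toCatOver) O'.fib =
      assemble (C := O.toCatOver) O.fib ⋙ G.functor := by
  refine Arrow.functor_ext fun a b g => ?_
  refine Eq.trans ?_
    (arrow_map_congr G.functor (arrow_assemble_map (C := O.toCatOver) O.fib g)).symm
  refine Eq.trans ?_ ((G.fib_map b.base b.idx _).trans (arrow_fib_map O' _)).symm
  refine arrow_map_congr (assemble (C := O'.toCatOver) O'.fib) (DecHom.arrow_ext ?_ rfl)
  exact congrArg (fun k => (⟨G.functor.obj b.base, k, G.functor.obj b.dom,
    G.functor.map b.map⟩ : DecObj _)) (eqToHom_relabel G.card_eq _ _ _)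

/-- The morphism of algebras underlying an operadic functor. -/
def algebraOfOperadicMap {O O' : OperadicCategory.{u}} (G : OperadicFunctor O O') :
    algebraOfOperadic O ⟶ algebraOfOperadic O' where
  f := strictHom G.functor G.isChosen G.card_eq
  h := strictSlice_hom_ext (assemble_naturality G)

/-- The functor from operadic categories to algebras. -/
def operadicToAlgebra : OperadicCategory.{u} ⥤ decMonad.{u}.Algebra where
  obj := algebraOfOperadic
  map := algebraOfOperadicMap
  map_id _ := Monad.Algebra.Hom.ext' _ _ _ _ (strictSlice_hom_ext rfl)
  map_comp _ _ := Monad.Algebra.Hom.ext' _ _ _ _ (strictSlice_hom_ext rfl)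

/-! ### The two constructions are mutually inverse -/

theorem algebraOfOperadic_operadicOfAlgebra (P : decMonad.{u}.Algebra) :
    algebraOfOperadic (operadicOfAlgebra P) = P :=
  algebra_ext (assemble_sliceIncl_comp (algFunctor P))

/-- Beyond the underlying category, the fibre functors are the only data; the remaining fields are
propositions. -/
theorem OperadicCategory.ext_fib {A : LtCatOver.{u}}
    {fib fib' : ∀ (X : A.carrier) (_ : Fin (A.card.obj X).n), Over X ⥤ A.carrier}
    {h1 h2 h3 h4 h5 h6 h7 h1' h2' h3' h4' h5' h6' h7'} (h : fib = fib') :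
    OperadicCategory.mk A fib h1 h2 h3 h4 h5 h6 h7 =
      OperadicCategory.mk A fib' h1' h2' h3' h4' h5' h6' h7' := by
  subst h
  rfl

theorem operadicOfAlgebra_algebraOfOperadic (O : OperadicCategory.{u}) :
    operadicOfAlgebra (algebraOfOperadic O) = O :=
  OperadicCategory.ext_fib (funext fun X => funext fun i =>
    sliceIncl_comp_assemble (C := O.toCatOver) O.fib X i)

/-- `Functor.hext` compares morphisms between algebras that are only propositionally equal. As the
round trip keeps the carriers, it suffices to substitute the structure maps; `operadic_hom_heq` does
the same with the fibre functors. -/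
theorem algebra_hom_heq {A B : StrictSlice.{u}} {a a' : decMonad.{u}.obj A ⟶ A}
    {b b' : decMonad.{u}.obj B ⟶ B} {ha hA ha' hA' hb hB hb' hB'} (h : a = a') (h' : b = b')
    (F : (⟨A, a, ha, hA⟩ : decMonad.{u}.Algebra) ⟶ ⟨B, b, hb, hB⟩)
    (G : (⟨A, a', ha', hA'⟩ : decMonad.{u}.Algebra) ⟶ ⟨B, b', hb', hB'⟩)
    (hFG : F.f = G.f) : F ≍ G := by
  subst h h'
  exact heq_of_eq (Monad.Algebra.Hom.ext' _ _ _ _ hFG)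

theorem operadic_hom_heq {A B : LtCatOver.{u}}
    {a a' : ∀ (X : A.carrier) (_ : Fin (A.card.obj X).n), Over X ⥤ A.carrier}
    {b b' : ∀ (X : B.carrier) (_ : Fin (B.card.obj X).n), Over X ⥤ B.carrier}
    {h1 h2 h3 h4 h5 h6 h7 h1' h2' h3' h4' h5' h6' h7'}
    {k1 k2 k3 k4 k5 k6 k7 k1' k2' k3' k4' k5' k6' k7'} (ha : a = a') (hb : b = b')
    (F : OperadicCategory.mk A a h1 h2 h3 h4 h5 h6 h7 ⟶
      OperadicCategory.mk B b k1 k2 k3 k4 k5 k6 k7)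
    (G : OperadicCategory.mk A a' h1' h2' h3' h4' h5' h6' h7' ⟶
      OperadicCategory.mk B b' k1' k2' k3' k4' k5' k6' k7')
    (hFG : OperadicFunctor.functor F = OperadicFunctor.functor G) : F ≍ G := by
  subst ha hb
  exact heq_of_eq (OperadicFunctor.ext_functor hFG)

theorem algebraToOperadic_comp_operadicToAlgebra :
    algebraToOperadic.{u} ⋙ operadicToAlgebra = 𝟭 _ :=
  Functor.hext algebraOfOperadic_operadicOfAlgebra fun P Q F =>
    algebra_hom_heq (strictSlice_hom_ext (assemble_sliceIncl_comp (algFunctor P)))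
      (strictSlice_hom_ext (assemble_sliceIncl_comp (algFunctor Q))) _ F
      (strictSlice_hom_ext rfl)

theorem operadicToAlgebra_comp_algebraToOperadic :
    operadicToAlgebra.{u} ⋙ algebraToOperadic = 𝟭 _ :=
  Functor.hext operadicOfAlgebra_algebraOfOperadic fun O O' G =>
    operadic_hom_heq
      (funext fun X => funext fun i => sliceIncl_comp_assemble (C := O.toCatOver) O.fib X i)
      (funext fun X => funext fun i => sliceIncl_comp_assemble (C := O'.toCatOver) O'.fib X i)
      _ G rfl

end Decalage

/-- The category of algebras for the modified décalage monad on `Cat_ℓt / 𝒮` is isomorphic to the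
category of operadic categories and operadic functors. -/
theorem theorem4 :
    ∃ (Φ : Decalage.decMonad.{u}.Algebra ⥤ Decalage.OperadicCategory.{u})
      (Ψ : Decalage.OperadicCategory.{u} ⥤ Decalage.decMonad.{u}.Algebra),
      Φ ⋙ Ψ = 𝟭 Decalage.decMonad.{u}.Algebra ∧
        Ψ ⋙ Φ = 𝟭 Decalage.OperadicCategory.{u} :=
  ⟨Decalage.algebraToOperadic, Decalage.operadicToAlgebra,
    Decalage.algebraToOperadic_comp_operadicToAlgebra,
    Decalage.operadicToAlgebra_comp_algebraToOperadic⟩
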